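/- Let $q$ be a prime power, let $t,n_1,\dots,n_t,m_1,\dots,m_t$ be positive integers with $m_1\ge\dots\ge m_t$ and $m_i\ge n_i$ for all $i$, and let $\mathbb M=\mathbb F_q^{m_1\times n_1}\times\dots\times\mathbb F_q^{m_t\times n_t}$. A code is an $\mathbb F_q$-linear subspace of $\mathbb M$. For $X=(X_1,\dots,X_t)\in\mathbb M$ let $\mathrm{srk}(X)=\sum_{i=1}^t\mathrm{rk}(X_i)$; for a code $\mathcal C$ let $\mathrm{maxsrk}(\mathcal C)=\max\{\mathrm{srk}(X):X\in\mathcal C\}$ and, if $\mathcal C\neq 0$, let $d(\mathcal C)=\min\{\mathrm{srk}(X):X\in\mathcal C\setminus\{0\}\}$. A linear subspace $\mathcal A_i\subseteq\mathbb F_q^{m_i\times n_i}$ is an optimal anticode if $\dim\mathcal A_i=m_i\max\{\mathrm{rk}(X):X\in\mathcal A_i\}$. Define $$\mathrm{wt}(\mathcal C)=\min\{\mathrm{maxsrk}(\mathcal A):\mathcal C\subseteq\mathcal A=\mathcal A_1\times\dots\times\mathcal A_t,\ \mathcal A_i\subseteq\mathbb F_q^{m_i\times n_i}\text{ an optimal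 anticode for all }i\},$$ and, for $1\le r\le\dim\mathcal C$, the $r$-th generalized sum-rank weight $$d_r(\mathcal C)=\min\{\mathrm{wt}(\mathcal C'):\mathcal C'\subseteq\mathcal C\text{ a linear subspace with }\dim\mathcal C'\ge r\}.$$ A code $\mathcal D\subseteq\mathbb M$ is MSRD (maximum sum-rank distance) if $\mathcal D\ne 0$ and there are $j\in\{1,\dots,t\}$ and $0\le\delta\le n_j-1$ with $d(\mathcal D)=\sum_{i=1}^{j-1}n_i+\delta+1$ and $\dim\mathcal D=\sum_{i=j}^t m_in_i-\delta m_j$. Proposition. Let $\mathcal C\subseteq\mathcal D\subseteq\mathbb M$ be codes and assume that $\mathcal D$ is MSRD. Then the sequence $d_1(\mathcal C),\dots,d_{\dim\mathcal C}(\mathcal C)$ of generalized weights of $\mathcal C$ is a subsequence of the sequence $d_1(\mathcal D),\dots,d_{\dim\mathcal D}(\mathcal D)$ of generalized weights of $\mathcal D$; that is, there are indices $1\le s_1<\dots<s_{\dim\mathcal C}\le\dim\mathcal D$ with $d_r(\mathcal C)=d_{s_r}(\mathcal D)$ for $1\le r\le\dim\mathcal C$. -/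

import Mathlib

namespace SumRank

/-- The ambient space `𝕄 = F^(m₁ × n₁) × ⋯ × F^(m_t × n_t)`. A (linear) sum-rank metric code is a
`Submodule F (Ambient F m n)`. -/
abbrev Ambient (F : Type*) {t : ℕ} (m n : Fin t → ℕ) : Type _ :=
  (i : Fin t) → Matrix (Fin (m i)) (Fin (n i)) F

/-- The sum-rank weight of a tuple of matrices. -/
noncomputable def srk {F : Type*} [Field F] {t : ℕ} {m n : Fin t → ℕ}
    (X : Ambient F m n) : ℕ :=
  ∑ i, (X i).rank

/-- The minimum distance of a nonzero code (the value for the zero code is irrelevant). -/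
noncomputable def minDist {F : Type*} [Field F] {t : ℕ} {m n : Fin t → ℕ}
    (C : Submodule F (Ambient F m n)) : ℕ :=
  sInf {d : ℕ | ∃ X ∈ C, X ≠ 0 ∧ srk X = d}

/-- The maximum sum-rank distance of a code: the maximum of the (nonempty, bounded) set of the
sum-rank weights of its elements. -/
noncomputable def maxsrk {F : Type*} [Field F] {t : ℕ} {m n : Fin t → ℕ}
    (C : Submodule F (Ambient F m n)) : ℕ :=
  sSup {d : ℕ | ∃ X ∈ C, srk X = d}

/-- The maximum rank of an element of a linear space of `a × b` matrices. -/
noncomputable def maxrk {F : Type*} [Field F] {a b : ℕ}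
    (A : Submodule F (Matrix (Fin a) (Fin b) F)) : ℕ :=
  sSup {d : ℕ | ∃ X ∈ A, X.rank = d}

/-- A linear space of `a × b` matrices (`b ≤ a`) is an optimal anticode if it attains the bound
`dim A ≤ a * maxrk A`. -/
def IsOptimalAnticode {F : Type*} [Field F] {a b : ℕ}
    (A : Submodule F (Matrix (Fin a) (Fin b) F)) : Prop :=
  Module.finrank F A = a * maxrk A

/-- The weight of a code: the least maximum sum-rank distance of a product `A₁ × ⋯ × A_t` of
optimal anticodes that contains the code. -/
noncomputable def wt {F : Type*} [Field F] {t : ℕ} {m n : Fin t → ℕ}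
    (C : Submodule F (Ambient F m n)) : ℕ :=
  sInf {w : ℕ | ∃ A : (i : Fin t) → Submodule F (Matrix (Fin (m i)) (Fin (n i)) F),
    (∀ i, IsOptimalAnticode (A i)) ∧ C ≤ Submodule.pi Set.univ A ∧
      maxsrk (Submodule.pi Set.univ A) = w}

/-- The `r`-th generalized sum-rank weight `d_r(C)`, meant for `1 ≤ r ≤ dim C`. -/
noncomputable def genWeight {F : Type*} [Field F] {t : ℕ} {m n : Fin t → ℕ}
    (C : Submodule F (Ambient F m n)) (r : ℕ) : ℕ :=
  sInf {w : ℕ | ∃ D : Submodule F (Ambient F m n), D ≤ C ∧ r ≤ Module.finrank F D ∧ wt D = w}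

/-- The sequence `d_1(C), …, d_k(C)` of generalized weights, `k = dim C`; the entry at the
zero-based index `r` is `d_{r+1}(C)`. -/
noncomputable def genWeightSeq {F : Type*} [Field F] {t : ℕ} {m n : Fin t → ℕ}
    (C : Submodule F (Ambient F m n)) : Fin (Module.finrank F C) → ℕ :=
  fun r => genWeight C (r + 1)

/-- Maximum sum-rank distance codes: for some block `j` and some `0 ≤ δ ≤ n_j - 1`,
`d(C) = ∑_{i<j} n_i + δ + 1` and `dim C = ∑_{i≥j} m_i n_i - δ m_j`. -/
def IsMSRD {F : Type*} [Field F] {t : ℕ} {m n : Fin t → ℕ}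
    (C : Submodule F (Ambient F m n)) : Prop :=
  ∃ (j : Fin t) (δ : ℕ), δ < n j ∧
    minDist C = ∑ i ∈ Finset.Iio j, n i + δ + 1 ∧
    Module.finrank F C + δ * m j = ∑ i ∈ Finset.Ici j, m i * n i

/-- A finite sequence `a` is a subsequence of a finite sequence `b`. -/
def IsSubsequence {k l : ℕ} (a : Fin k → ℕ) (b : Fin l → ℕ) : Prop :=
  ∃ f : Fin k → Fin l, StrictMono f ∧ ∀ r, a r = b (f r)

end SumRank

/-!
By Flanders' bound, a space of linear maps between spaces of dimension at most `d`, all of rank at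
most `k`, has dimension at most `d * k`; in the case of equality it consists of all maps vanishing
on a fixed subspace or of all maps with values in a fixed subspace. Hence every nonzero optimal
anticode contains one whose maximal rank is smaller by one, and replacing a factor of an optimal
product anticode by such a subspace lowers the weight of a code while losing at most `m i`
dimensions. So a value `w` with `n₁ + ⋯ + n_{i-1} < w ≤ n₁ + ⋯ + n_i` occurs at most `m i` times
among the generalized weights of any code. The dimension of an MSRD code `D` forces equality for all
such `w ≥ d(D)`, and the generalized weights of a subcode of `D` are at least `d(D)`: every value is
taken at least as often for `D` as for the subcode, and both sequences are monotone.
-/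

namespace SumRank

open Module LinearMap

section LinearAlgebra

variable {K V W : Type*} [Field K] [AddCommGroup V] [Module K V] [AddCommGroup W] [Module K W]

lemma finrank_map_add_finrank_inf_ker [FiniteDimensional K V] (S : Submodule K V) (f : V →ₗ[K] W) :
    finrank K (S.map f) + finrank K (S ⊓ ker f : Submodule K V) = finrank K S := by
  rw [← finrank_range_add_finrank_ker (f.domRestrict S), range_domRestrict, ker_domRestrict,
    ← Submodule.map_comap_subtype, LinearEquiv.finrank_eq (Submodule.equivSubtypeMap S _)]

lemma finrank_le_finrank_inf_comap [FiniteDimensional K V] [FiniteDimensional K W]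
    {C : Submodule K V} {A A' : Submodule K W} (f : V →ₗ[K] W) (hC : C.map f ≤ A) (hA : A' ≤ A) :
    finrank K C + finrank K A' ≤ finrank K (C ⊓ A'.comap f : Submodule K V) + finrank K A := by
  have h_ker : C ⊓ ker (A'.mkQ ∘ₗ f) = C ⊓ A'.comap f := by
    rw [ker_comp, Submodule.ker_mkQ]
  have h_map : C.map (A'.mkQ ∘ₗ f) ≤ A.map A'.mkQ := by
    rw [Submodule.map_comp]
    exact Submodule.map_mono hC
  have hC' := finrank_map_add_finrank_inf_ker C (A'.mkQ ∘ₗ f)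
  have hA' := finrank_map_add_finrank_inf_ker A A'.mkQ
  rw [h_ker] at hC'
  rw [Submodule.ker_mkQ, inf_eq_right.2 hA] at hA'
  have := Submodule.finrank_mono h_map
  omega

lemma exists_le_finrank_eq (L : Submodule K V) {k : ℕ} (hk : k ≤ finrank K L) :
    ∃ L' ≤ L, finrank K L' = k := by
  obtain ⟨v, hv⟩ := exists_linearIndependent_of_le_finrank hk
  refine ⟨(Submodule.span K (Set.range v)).map L.subtype, Submodule.map_subtype_le _ _, ?_⟩
  rw [← LinearEquiv.finrank_eq (Submodule.equivSubtypeMap L _), finrank_span_eq_card hv,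
    Fintype.card_fin]

lemma exists_linearIndependent_mem {r : ℕ} (L : Fin r → Submodule K V)
    (hL : ∀ j : Fin r, (j : ℕ) < finrank K (L j)) :
    ∃ v : Fin r → V, LinearIndependent K v ∧ ∀ j, v j ∈ L j := by
  induction r with
  | zero => exact ⟨Fin.elim0, linearIndependent_empty_type, fun j => j.elim0⟩
  | succ r ih =>
    obtain ⟨v, hv, hvL⟩ := ih (fun j => L j.castSucc) fun j => hL j.castSucc
    obtain ⟨x, hxL, hx⟩ : ∃ x ∈ L (Fin.last r), x ∉ Submodule.span K (Set.range v) := by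
      refine SetLike.not_le_iff_exists.1 fun h => ?_
      have := FiniteDimensional.span_of_finite K (Set.finite_range v)
      have h_le := Submodule.finrank_mono h
      rw [finrank_span_eq_card hv, Fintype.card_fin] at h_le
      exact h_le.not_gt (hL (Fin.last r))
    exact ⟨Fin.snoc (α := fun _ => V) v x, linearIndependent_finSnoc.2 ⟨hv, hx⟩,
      Fin.lastCases (by simpa) (by simpa)⟩

lemma exists_linearEquiv_apply_eq {x y : V} (hx : x ≠ 0) (hy : y ≠ 0) :
    ∃ e : V ≃ₗ[K] V, e x = y := by
  obtain ⟨e, he⟩ := Submodule.exists_linearEquiv_restrict_eq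
    (LinearEquiv.coord K V x hx ≪≫ₗ LinearEquiv.toSpanNonzeroSingleton K V y hy)
  refine ⟨e, ?_⟩
  rw [← he ⟨x, Submodule.mem_span_singleton_self x⟩, LinearEquiv.trans_apply,
    LinearEquiv.coord_self, LinearEquiv.toSpanNonzeroSingleton_one]

lemma eq_sum_coord_smulRight {ι : Type*} [Fintype ι] (b : Basis ι K V) (f : V →ₗ[K] W) :
    f = ∑ i, (b.coord i).smulRight (f (b i)) := by
  classical
  exact b.ext fun i => by simp [Finsupp.single_apply]

variable [FiniteDimensional K V] [FiniteDimensional K W]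

lemma exists_surjective_of_finrank_le (h : finrank K W ≤ finrank K V) :
    ∃ f : V →ₗ[K] W, Function.Surjective f := by
  obtain ⟨i, hi⟩ := finrank_le_iff_exists_linearMap.1 h
  obtain ⟨f, hf⟩ := i.exists_leftInverse_of_injective (ker_eq_bot.2 hi)
  exact ⟨f, fun y => ⟨i y, LinearMap.congr_fun hf y⟩⟩

lemma surjective_smulRight_of_ker_eq_bot (h : finrank K W ≤ finrank K V)
    {φ : Dual K V} (hφ : ker φ = ⊥) {z : W} (hz : z ≠ 0) :
    Function.Surjective (φ.smulRight z) := by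
  have hV : finrank K V ≤ 1 := (finrank_le_finrank_of_injective (ker_eq_bot.1 hφ)).trans_eq
    (finrank_self K)
  have hW : 0 < finrank K W := finrank_pos_iff_exists_ne_zero.2 ⟨z, hz⟩
  refine (injective_iff_surjective_of_finrank_eq_finrank (by omega)).1 ?_
  exact (smul_left_injective K hz).comp (ker_eq_bot.1 hφ)

lemma smulRight_mem_span_surjective (h : finrank K W ≤ finrank K V)
    (φ : Dual K V) (z : W) :
    φ.smulRight z ∈ Submodule.span K {f : V →ₗ[K] W | Function.Surjective f} := by
  obtain rfl | hz := eq_or_ne z 0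
  · simp
  obtain hφ | hφ := eq_or_ne (ker φ) ⊥
  · exact Submodule.subset_span (surjective_smulRight_of_ker_eq_bot h hφ hz)
  -- A surjection mapping some `0 ≠ w ∈ ker φ` to `z` differs by `φ ⊗ z` from its composite with
  -- the transvection `x ↦ x + φ x • w`.
  obtain ⟨w, hφw : φ w = 0, hw⟩ := Submodule.exists_mem_ne_zero_of_ne_bot hφ
  obtain ⟨f, hf, hfw⟩ : ∃ f : V →ₗ[K] W, Function.Surjective f ∧ f w = z := by
    obtain ⟨g, hg⟩ := exists_surjective_of_finrank_le h
    obtain ⟨u, rfl⟩ := hg z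
    obtain ⟨e, rfl⟩ := exists_linearEquiv_apply_eq (K := K) hw (y := u) (by rintro rfl; simp at hz)
    exact ⟨g ∘ₗ e.toLinearMap, hg.comp e.surjective, rfl⟩
  have h_eq : φ.smulRight z = f ∘ₗ (LinearEquiv.transvection hφw).toLinearMap - f := by
    ext x
    simp [transvection.apply, hfw]
  rw [h_eq]
  exact sub_mem (Submodule.subset_span (hf.comp (LinearEquiv.transvection hφw).surjective))
    (Submodule.subset_span hf)

lemma span_surjective_eq_top (h : finrank K W ≤ finrank K V) :
    Submodule.span K {f : V →ₗ[K] W | Function.Surjective f} = ⊤ := by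
  refine eq_top_iff.2 fun f _ => ?_
  rw [eq_sum_coord_smulRight (finBasis K V) f]
  exact sum_mem fun i _ => smulRight_mem_span_surjective h _ _

end LinearAlgebra

section BoundedRank

variable {K V W : Type*} [Field K] [AddCommGroup V] [Module K V] [AddCommGroup W] [Module K W]

/-- The rank-one maps `φ ⊗ w : x ↦ φ x • w` in `S`, for a fixed `w ≠ 0`, as a space of functionals
`φ`. -/
def slice (S : Submodule K (V →ₗ[K] W)) (w : W) : Submodule K (Dual K V) :=
  S.comap (smulRightₗ.flip w)

/-- Every map in `S` has rank at most `k`: the coordinate-free form of an anticode of maximal rank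
at most `k`. -/
def RankBounded (S : Submodule K (V →ₗ[K] W)) (k : ℕ) : Prop :=
  ∀ f ∈ S, finrank K (range f) ≤ k

/-- The map that `f : V → W` induces between the hyperplane `ker φ` and the quotient `W ⧸ ⟨w⟩`. It
lowers a rank bound on `S` by one if `φ ⊗ w ∈ S`, which drives the inductions on the rank. -/
def compress (φ : Dual K V) (w : W) : (V →ₗ[K] W) →ₗ[K] (ker φ →ₗ[K] W ⧸ K ∙ w) :=
  lcomp K (W ⧸ K ∙ w) (ker φ).subtype ∘ₗ compRight K (K ∙ w).mkQ

variable {S : Submodule K (V →ₗ[K] W)} {k : ℕ}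

lemma mem_slice {w : W} {φ : Dual K V} : φ ∈ slice S w ↔ φ.smulRight w ∈ S := Iff.rfl

lemma slice_smul {c : K} (hc : c ≠ 0) (w : W) : slice S (c • w) = slice S w := by
  ext φ
  have : φ.smulRight (c • w) = c • φ.smulRight w := by
    ext x
    exact smul_comm (φ x) c w
  rw [mem_slice, mem_slice, this, S.smul_mem_iff hc]

lemma RankBounded.map_mkQ [FiniteDimensional K W] (hS : RankBounded S k) (w : W) :
    RankBounded (S.map (compRight K (K ∙ w).mkQ)) k := by
  rintro _ ⟨f, hf, rfl⟩
  rw [compRight_apply, range_comp]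
  exact (Submodule.finrank_map_le _ _).trans (hS f hf)

lemma RankBounded.map_compress [FiniteDimensional K W] (hS : RankBounded S k) {φ : Dual K V}
    (hφ : φ ≠ 0) {w : W} (hw : w ≠ 0) (hφS : φ ∈ slice S w) :
    RankBounded (S.map (compress φ w)) (k - 1) := by
  rintro _ ⟨f, hf, rfl⟩
  set P := (ker φ).map f
  have h_range : range (compress φ w f) = P.map (K ∙ w).mkQ := by
    have : compress φ w f = (K ∙ w).mkQ ∘ₗ f ∘ₗ (ker φ).subtype := rfl
    rw [this, range_comp, range_comp, Submodule.range_subtype]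
  by_contra! hk
  rw [h_range] at hk
  have hP_dim := finrank_map_add_finrank_inf_ker P (K ∙ w).mkQ
  have eq_range {g : V →ₗ[K] W} (hg : g ∈ S) (hPg : P ≤ range g) : P = range g :=
    Submodule.eq_of_le_of_finrank_le hPg ((hS g hg).trans (by omega))
  have hPf : P = range f := eq_range hf (map_le_range)
  have hPg : P = range (f + φ.smulRight w) := by
    refine eq_range (S.add_mem hf hφS) ?_
    rintro _ ⟨x, hx, rfl⟩
    exact ⟨x, by simp [mem_ker.1 hx]⟩
  have hwP : w ∈ P := by
    obtain ⟨x, hx⟩ := DFunLike.ne_iff.1 hφ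
    have h_fx : f x ∈ P := hPf ▸ mem_range_self f x
    have h_gx : f x + φ x • w ∈ P := hPg ▸ mem_range_self (f + φ.smulRight w) x
    exact (P.smul_mem_iff hx).1 ((P.add_mem_iff_right h_fx).1 h_gx)
  have h_rank := hS f hf
  rw [Submodule.ker_mkQ, inf_eq_right.2 ((Submodule.span_singleton_le_iff_mem w P).2 hwP),
    finrank_span_singleton hw] at hP_dim
  rw [← hPf] at h_rank
  omega

lemma smulRightₗ_flip_injective {w : W} (hw : w ≠ 0) :
    Function.Injective (smulRightₗ.flip w : Dual K V →ₗ[K] V →ₗ[K] W) :=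
  fun _ _ h => LinearMap.ext fun x => smul_left_injective K hw (LinearMap.congr_fun h x)

lemma ker_compRight_mkQ {w : W} (hw : w ≠ 0) :
    ker (compRight K (K ∙ w).mkQ : (V →ₗ[K] W) →ₗ[K] _) = range (smulRightₗ.flip w) := by
  refine le_antisymm (fun f hf => ?_) ?_
  · have hfw (x : V) : f x ∈ K ∙ w :=
      (Submodule.Quotient.mk_eq_zero _).1 (LinearMap.congr_fun hf x)
    exact ⟨(LinearEquiv.coord K W w hw).toLinearMap ∘ₗ f.codRestrict _ hfw,
      LinearMap.ext fun x => LinearEquiv.coord_apply_smul K W w hw ⟨f x, hfw x⟩⟩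
  · rintro _ ⟨φ, rfl⟩
    ext x
    exact (Submodule.Quotient.mk_eq_zero _).2
      (Submodule.smul_mem _ _ (Submodule.mem_span_singleton_self w))

lemma ker_lcomp_subtype_ker_le {φ : Dual K V} (hφ : φ ≠ 0) :
    ker (lcomp K W (ker φ).subtype) ≤ range (smulRightₗ φ) := by
  intro f hf
  obtain ⟨x₀, hx₀⟩ := LinearMap.surjective hφ 1
  refine ⟨f x₀, LinearMap.ext fun x => ?_⟩
  have h_ker : x - φ x • x₀ ∈ ker φ := by simp [hx₀]
  have h_sub : f x - φ x • f x₀ = 0 := by simpa using LinearMap.congr_fun hf ⟨_, h_ker⟩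
  exact (sub_eq_zero.1 h_sub).symm

lemma finrank_map_mkQ_add_finrank_slice [FiniteDimensional K V] [FiniteDimensional K W]
    (S : Submodule K (V →ₗ[K] W)) {w : W} (hw : w ≠ 0) :
    finrank K (S.map (compRight K (K ∙ w).mkQ)) + finrank K (slice S w) = finrank K S := by
  rw [← finrank_map_add_finrank_inf_ker S (compRight K (K ∙ w).mkQ), ker_compRight_mkQ hw,
    inf_comm, ← Submodule.map_comap_eq, slice, LinearEquiv.finrank_eq
      (Submodule.equivMapOfInjective _ (smulRightₗ_flip_injective hw) _)]

lemma finrank_lt_finrank_map_compress_add [FiniteDimensional K V] [FiniteDimensional K W]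
    (S : Submodule K (V →ₗ[K] W)) {φ : Dual K V} (hφ : φ ≠ 0) {w : W} (hw : w ≠ 0) :
    finrank K S < finrank K (S.map (compress φ w)) + finrank K W + finrank K (slice S w) := by
  set T := S.map (compRight K (K ∙ w).mkQ) with hT
  have h_mkQ : finrank K T + finrank K (slice S w) = finrank K S :=
    finrank_map_mkQ_add_finrank_slice S hw
  have h_restrict := finrank_map_add_finrank_inf_ker T (lcomp K _ (ker φ).subtype)
  have h_ker : finrank K (T ⊓ ker (lcomp K _ (ker φ).subtype) : Submodule K _) ≤
      finrank K (W ⧸ K ∙ w) :=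
    (Submodule.finrank_mono (inf_le_right.trans (ker_lcomp_subtype_ker_le hφ))).trans
      (finrank_range_le _)
  have h_quot := (K ∙ w).finrank_quotient_add_finrank
  rw [finrank_span_singleton hw] at h_quot
  rw [hT, ← Submodule.map_comp, ← hT] at h_restrict
  change finrank K (S.map (compress φ w)) + _ = _ at h_restrict
  omega

lemma range_pi_eq_top {ι : Type*} [Finite ι] {φ : ι → Dual K V} (hφ : LinearIndependent K φ) :
    range (LinearMap.pi φ) = ⊤ := by
  have h_coe : LinearIndependent K fun i => (φ i : V → K) :=
    hφ.map' (ltoFun K V K K) (ker_eq_bot.2 DFunLike.coe_injective)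
  rw [eq_top_iff, ← span_flip_eq_top_iff_linearIndependent.2 h_coe, Submodule.span_le]
  rintro _ ⟨x, rfl⟩
  exact ⟨x, rfl⟩

lemma finrank_range_sum_smulRight {ι : Type*} [Fintype ι] {φ : ι → Dual K V}
    (hφ : LinearIndependent K φ) {w : ι → W} (hw : LinearIndependent K w) :
    finrank K (range (∑ i, (φ i).smulRight (w i))) = Fintype.card ι := by
  have h_comp : ∑ i, (φ i).smulRight (w i) = Fintype.linearCombination K w ∘ₗ LinearMap.pi φ := by
    ext x
    simp [Fintype.linearCombination_apply]
  rw [h_comp, range_comp, range_pi_eq_top hφ, Submodule.map_top, Fintype.range_linearCombination,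
    finrank_span_eq_card hw]

lemma RankBounded.card_le (hS : RankBounded S k) {ι : Type*} [Fintype ι] {φ : ι → Dual K V}
    (hφ : LinearIndependent K φ) {w : ι → W} (hw : LinearIndependent K w)
    (hφw : ∀ i, φ i ∈ slice S (w i)) : Fintype.card ι ≤ k := by
  rw [← finrank_range_sum_smulRight hφ hw]
  exact hS _ (sum_mem fun i _ => hφw i)

-- If the slice at `w` had dimension above `k`, one could pick `k + 1` independent functionals from
-- slices at `k + 1` independent vectors; the sum of these rank-one maps would have rank `k + 1`.
lemma RankBounded.finrank_slice_le (hS : RankBounded S k) (hk : k < finrank K W)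
    (hslice : ∀ w ≠ 0, k ≤ finrank K (slice S w)) {w : W} (hw : w ≠ 0) :
    finrank K (slice S w) ≤ k := by
  by_contra! hlt
  obtain ⟨v, hv, hvL⟩ := exists_linearIndependent_mem
    (fun j : Fin (k + 1) => if j = 0 then K ∙ w else ⊤) fun j => by
      obtain rfl | hj := eq_or_ne j 0
      · rw [if_pos rfl, finrank_span_singleton hw, Fin.val_zero]
        exact one_pos
      · rw [if_neg hj, finrank_top]
        omega
  have h_dim (j : Fin (k + 1)) : (j.rev : ℕ) < finrank K (slice S (v j)) := by
    obtain rfl | hj := eq_or_ne j 0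
    · have hv0 := hvL 0
      rw [if_pos rfl] at hv0
      obtain ⟨c, hc⟩ := Submodule.mem_span_singleton.1 hv0
      have hc0 : c ≠ 0 := by
        rintro rfl
        exact hv.ne_zero 0 (by simpa using hc.symm)
      rw [← hc, slice_smul hc0]
      simpa using hlt
    · have := hslice (v j) (hv.ne_zero j)
      have : (j : ℕ) ≠ 0 := Fin.val_ne_zero_iff.2 hj
      rw [Fin.val_rev]
      omega
  obtain ⟨φ, hφ, hφL⟩ := exists_linearIndependent_mem (fun j : Fin (k + 1) => slice S (v j.rev))
    fun j => by simpa using h_dim j.rev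
  have := hS.card_le hφ (hv.comp _ Fin.rev_injective) hφL
  simp at this

lemma RankBounded.exists_finrank_slice_le [FiniteDimensional K W] (hS : RankBounded S k)
    (hk : k < finrank K W) :
    ∃ w ≠ 0, finrank K (slice S w) ≤ k := by
  by_contra! h
  obtain ⟨w, hw⟩ := finrank_pos_iff_exists_ne_zero.1 (hk.trans_le' (Nat.zero_le k))
  exact (hS.finrank_slice_le hk (fun w hw => (h w hw).le) hw).not_gt (h w hw)

theorem RankBounded.finrank_le [FiniteDimensional K V] [FiniteDimensional K W] {d : ℕ}
    (hS : RankBounded S k) (hV : finrank K V ≤ d) (hW : finrank K W ≤ d) :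
    finrank K S ≤ d * k := by
  induction h : finrank K W using Nat.strong_induction_on generalizing V W k d with
  | _ l ih =>
  obtain hk | hk := le_or_gt (finrank K W) k
  · calc finrank K S ≤ finrank K V * finrank K W := by
          rw [← finrank_linearMap K K]
          exact S.finrank_le
      _ ≤ d * k := Nat.mul_le_mul hV hk
  obtain ⟨w, hw, h_slice⟩ := hS.exists_finrank_slice_le hk
  have h_quot := (K ∙ w).finrank_quotient_add_finrank
  rw [finrank_span_singleton hw] at h_quot
  obtain h_bot | h_ne := eq_or_ne (slice S w) ⊥
  · rw [← finrank_map_mkQ_add_finrank_slice S hw, h_bot, finrank_bot, add_zero]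
    exact ih _ (by omega) (hS.map_mkQ w) hV (by omega) rfl
  · obtain ⟨φ, hφS, hφ⟩ := Submodule.exists_mem_ne_zero_of_ne_bot h_ne
    have h_ker := Dual.finrank_ker_add_one_of_ne_zero hφ
    have h_compress : finrank K (S.map (compress φ w)) ≤ (d - 1) * (k - 1) :=
      ih _ (by omega) (hS.map_compress hφ hw hφS) (by omega) (by omega) rfl
    have h_lt := finrank_lt_finrank_map_compress_add S hφ hw
    have h_pos : 0 < finrank K (slice S w) := Submodule.one_le_finrank_iff.2 h_ne
    obtain ⟨k, rfl⟩ := Nat.exists_eq_add_one.2 (h_pos.trans_le h_slice)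
    obtain ⟨d, rfl⟩ := Nat.exists_eq_add_one.2 (show 0 < d by omega)
    simp only [Nat.add_sub_cancel] at h_compress
    linarith

lemma RankBounded.add_le_finrank_slice_add [FiniteDimensional K V] [FiniteDimensional K W] {d : ℕ}
    (hS : RankBounded S k) (hV : finrank K V ≤ d) (hW : finrank K W ≤ d) (hk : 0 < k)
    (hdim : finrank K S = d * k) {w : W} (hw : w ≠ 0) (h_ne : slice S w ≠ ⊥) :
    d + k ≤ finrank K (slice S w) + finrank K W := by
  obtain ⟨φ, hφS, hφ⟩ := Submodule.exists_mem_ne_zero_of_ne_bot h_ne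
  have h_ker := Dual.finrank_ker_add_one_of_ne_zero hφ
  have h_quot := (K ∙ w).finrank_quotient_add_finrank
  rw [finrank_span_singleton hw] at h_quot
  have h_compress : finrank K (S.map (compress φ w)) ≤ (d - 1) * (k - 1) :=
    (hS.map_compress hφ hw hφS).finrank_le (by omega) (by omega)
  have h_lt := finrank_lt_finrank_map_compress_add S hφ hw
  obtain ⟨k, rfl⟩ := Nat.exists_eq_add_one.2 hk
  obtain ⟨d, rfl⟩ := Nat.exists_eq_add_one.2 (show 0 < d by omega)
  simp only [Nat.add_sub_cancel] at h_compress
  linarith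

lemma map_restrict_slice_le (S : Submodule K (V →ₗ[K] W)) (φ : Dual K V) (u w : W) :
    (slice S w).map (lcomp K K (ker φ).subtype) ≤
      slice (S.map (compress φ u)) ((K ∙ u).mkQ w) := by
  rintro _ ⟨ψ, hψ, rfl⟩
  exact ⟨ψ.smulRight w, hψ, LinearMap.ext fun x => (K ∙ u).mkQ.map_smul (ψ x) w⟩

lemma finrank_slice_le_finrank_slice_map_compress_add_one [FiniteDimensional K V]
    (S : Submodule K (V →ₗ[K] W)) {φ : Dual K V} (hφ : φ ≠ 0) (u w : W) :
    finrank K (slice S w) ≤ finrank K (slice (S.map (compress φ u)) ((K ∙ u).mkQ w)) + 1 := by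
  rw [← finrank_map_add_finrank_inf_ker (slice S w) (lcomp K K (ker φ).subtype)]
  refine add_le_add (Submodule.finrank_mono (map_restrict_slice_le S φ u w)) ?_
  calc finrank K (slice S w ⊓ ker (lcomp K K (ker φ).subtype) : Submodule K (Dual K V))
      ≤ finrank K (range (smulRightₗ φ : K →ₗ[K] Dual K V)) :=
        Submodule.finrank_mono (inf_le_right.trans (ker_lcomp_subtype_ker_le hφ))
    _ ≤ 1 := (finrank_range_le _).trans_eq (finrank_self K)

lemma finrank_slice_le_finrank_slice_map_compress [FiniteDimensional K V]
    {φ : Dual K V} (u : W) {w : W} (hφ : φ ∉ slice S w) :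
    finrank K (slice S w) ≤ finrank K (slice (S.map (compress φ u)) ((K ∙ u).mkQ w)) := by
  have h_inf : slice S w ⊓ ker (lcomp K K (ker φ).subtype) = ⊥ := by
    refine (Submodule.eq_bot_iff _).2 fun ψ ⟨hψ, hψ_ker⟩ => ?_
    have hφ0 : φ ≠ 0 := fun h => hφ (h ▸ zero_mem _)
    obtain ⟨c, rfl⟩ := ker_lcomp_subtype_ker_le hφ0 hψ_ker
    have h_smul : smulRightₗ φ c = c • φ := LinearMap.ext fun x => mul_comm (φ x) c
    rw [h_smul] at hψ ⊢
    by_contra h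
    exact hφ (((slice S w).smul_mem_iff (left_ne_zero_of_smul h)).1 hψ)
  rw [← finrank_map_add_finrank_inf_ker (slice S w) (lcomp K K (ker φ).subtype), h_inf,
    finrank_bot, add_zero]
  exact Submodule.finrank_mono (map_restrict_slice_le S φ u w)

lemma RankBounded.slice_le_slice [FiniteDimensional K V] [FiniteDimensional K W]
    (hS : RankBounded S k) (hk : 0 < k) (hkW : k < finrank K W)
    (hslice : ∀ w ≠ 0, k ≤ finrank K (slice S w)) {u w : W} (hu : u ≠ 0) (hw : w ≠ 0) :
    slice S u ≤ slice S w := by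
  by_contra h_not_le
  obtain ⟨φ, hφu, hφw⟩ := SetLike.not_le_iff_exists.1 h_not_le
  have hφ : φ ≠ 0 := fun h => hφw (h ▸ zero_mem _)
  have hwu : (K ∙ u).mkQ w ≠ 0 := by
    intro h
    obtain ⟨c, rfl⟩ := Submodule.mem_span_singleton.1 ((Submodule.Quotient.mk_eq_zero _).1 h)
    have hc : c ≠ 0 := fun h => hw (by rw [h, zero_smul])
    exact hφw ((slice_smul hc u).ge hφu)
  have h_quot := (K ∙ u).finrank_quotient_add_finrank
  rw [finrank_span_singleton hu] at h_quot
  have h_compress : ∀ v ≠ 0, k - 1 ≤ finrank K (slice (S.map (compress φ u)) v) := by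
    intro v hv
    obtain ⟨v, rfl⟩ := (K ∙ u).mkQ_surjective v
    have := hslice v (by rintro rfl; simp at hv)
    have := finrank_slice_le_finrank_slice_map_compress_add_one S hφ u v
    omega
  have h_le := (hS.map_compress hφ hu hφu).finrank_slice_le (by omega) h_compress hwu
  have := finrank_slice_le_finrank_slice_map_compress u hφw
  have := hslice w hw
  omega

section Range

variable {Q Z : Type*} [AddCommGroup Q] [Module K Q] [AddCommGroup Z] [Module K Z]

lemma finrank_range_lcomp [FiniteDimensional K Q] [FiniteDimensional K W] {p : V →ₗ[K] Q}
    (hp : Function.Surjective p) :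
    finrank K (range (lcomp K W p)) = finrank K Q * finrank K W := by
  rw [finrank_range_of_inj (lcomp_injective_of_surjective p hp), finrank_linearMap]

lemma finrank_range_compRight [FiniteDimensional K V] [FiniteDimensional K Z] {i : Z →ₗ[K] W}
    (hi : Function.Injective i) :
    finrank K (range (compRight K i : (V →ₗ[K] Z) →ₗ[K] _)) = finrank K V * finrank K Z := by
  rw [finrank_range_of_inj fun f g h => (cancel_left hi).1 h, finrank_linearMap]

lemma rankBounded_range_lcomp [FiniteDimensional K Q] (p : V →ₗ[K] Q) :
    RankBounded (range (lcomp K W p)) (finrank K Q) := by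
  rintro _ ⟨f, rfl⟩
  exact (Submodule.finrank_mono (range_comp_le_range p f)).trans (finrank_range_le f)

lemma rankBounded_range_compRight [FiniteDimensional K Z] (i : Z →ₗ[K] W) :
    RankBounded (range (compRight K i : (V →ₗ[K] Z) →ₗ[K] _)) (finrank K Z) := by
  rintro _ ⟨f, rfl⟩
  exact (Submodule.finrank_mono (range_comp_le_range f i)).trans (finrank_range_le i)

end Range

lemma range_lcomp_mkQ_le [FiniteDimensional K V] [FiniteDimensional K W]
    {L : Submodule K (Dual K V)} (hL : ∀ w ≠ 0, L ≤ slice S w) :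
    range (lcomp K W L.dualCoannihilator.mkQ) ≤ S := by
  rintro _ ⟨f, rfl⟩
  let b := finBasis K W
  set g := lcomp K W L.dualCoannihilator.mkQ f with hg
  have h_sum : g = ∑ i, (b.coord i ∘ₗ g).smulRight (b i) :=
    LinearMap.ext fun x => by simp
  have h_coord (i) : b.coord i ∘ₗ g ∈ L := by
    rw [← Subspace.dualCoannihilator_dualAnnihilator_eq (W := L), Submodule.mem_dualAnnihilator]
    intro x hx
    have hgx : g x = 0 := by simp [hg, (Submodule.Quotient.mk_eq_zero _).2 hx]
    rw [comp_apply, hgx, map_zero]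
  rw [h_sum]
  exact sum_mem fun i _ => hL _ (b.ne_zero i) (h_coord i)

lemma finrank_quotient_dualCoannihilator [FiniteDimensional K V] (L : Submodule K (Dual K V)) :
    finrank K (V ⧸ L.dualCoannihilator) = finrank K L := by
  have h_quot := L.dualCoannihilator.finrank_quotient_add_finrank
  have h_dual := Subspace.finrank_add_finrank_dualCoannihilator_eq L
  omega

lemma RankBounded.eq_range_lcomp_mkQ [FiniteDimensional K V] [FiniteDimensional K W] {d : ℕ}
    (hS : RankBounded S k) (hV : finrank K V ≤ d) (hW : finrank K W ≤ d) (hk : 0 < k)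
    (hkW : k < finrank K W) (hdim : finrank K S = d * k) (h_ne : ∀ w ≠ 0, slice S w ≠ ⊥) :
    finrank K W = d ∧ ∃ U : Submodule K V, finrank K (V ⧸ U) = k ∧ S = range (lcomp K W U.mkQ) := by
  have h_slice {w : W} (hw : w ≠ 0) : k ≤ finrank K (slice S w) := by
    have := hS.add_le_finrank_slice_add hV hW hk hdim hw (h_ne w hw)
    omega
  obtain ⟨u, hu⟩ := finrank_pos_iff_exists_ne_zero.1 (hk.trans hkW)
  have hL : finrank K (slice S u) = k :=
    le_antisymm (hS.finrank_slice_le hkW (fun _ => h_slice) hu) (h_slice hu)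
  have hWd : finrank K W = d := by
    have := hS.add_le_finrank_slice_add hV hW hk hdim hu (h_ne u hu)
    omega
  have hU : finrank K (V ⧸ (slice S u).dualCoannihilator) = k := by
    rw [finrank_quotient_dualCoannihilator, hL]
  have h_le : range (lcomp K W (slice S u).dualCoannihilator.mkQ) ≤ S :=
    range_lcomp_mkQ_le fun w hw => hS.slice_le_slice hk hkW (fun _ => h_slice) hu hw
  refine ⟨hWd, _, hU, (Submodule.eq_of_le_of_finrank_eq h_le ?_).symm⟩
  rw [finrank_range_lcomp (Submodule.mkQ_surjective _), hU, hdim, hWd, mul_comm]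

section Lift

variable {w : W} {Z : Submodule K (W ⧸ K ∙ w)}

lemma eq_of_slice_eq_bot (hw : w ≠ 0) (h_bot : slice S w = ⊥) {f g : V →ₗ[K] W} (hf : f ∈ S)
    (hg : g ∈ S) (hfg : (K ∙ w).mkQ ∘ₗ f = (K ∙ w).mkQ ∘ₗ g) : f = g := by
  have h_ker : f - g ∈ ker (compRight K (K ∙ w).mkQ : (V →ₗ[K] W) →ₗ[K] _) := by
    rw [mem_ker, map_sub, sub_eq_zero]
    exact hfg
  rw [ker_compRight_mkQ hw] at h_ker
  obtain ⟨φ, hφ⟩ := h_ker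
  have hφS : φ ∈ slice S w := by
    rw [slice, Submodule.mem_comap, hφ]
    exact S.sub_mem hf hg
  rw [h_bot, Submodule.mem_bot] at hφS
  rw [hφS, map_zero] at hφ
  exact sub_eq_zero.1 hφ.symm

lemma RankBounded.disjoint_range_of_le_finrank [FiniteDimensional K W] (hS : RankBounded S k)
    {f : V →ₗ[K] W} (hf : f ∈ S) (hk : k ≤ finrank K (range ((K ∙ w).mkQ ∘ₗ f))) :
    Disjoint (range f) (K ∙ w) := by
  have h_split := finrank_map_add_finrank_inf_ker (range f) (K ∙ w).mkQ
  rw [← range_comp, Submodule.ker_mkQ] at h_split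
  have := hS f hf
  exact disjoint_iff.2 (Submodule.finrank_eq_zero.1 (by omega))

-- The maps `V ⧸ ⟨x⟩ → Z` that lift to an element of `S` vanishing at `x` form a subspace, and it
-- contains every surjection, since a lift of rank at most `k` meets `⟨w⟩` trivially.
lemma RankBounded.exists_lift_apply_eq_zero [FiniteDimensional K V] [FiniteDimensional K W]
    (hS : RankBounded S k) (hT : S.map (compRight K (K ∙ w).mkQ) = range (compRight K Z.subtype))
    (hZ : finrank K Z = k) (hkV : k < finrank K V) {x : V} (hx : x ≠ 0) (B : V ⧸ K ∙ x →ₗ[K] Z) :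
    ∃ g ∈ S, g x = 0 ∧ (K ∙ w).mkQ ∘ₗ g = Z.subtype ∘ₗ B ∘ₗ (K ∙ x).mkQ := by
  let P : Submodule K (V ⧸ K ∙ x →ₗ[K] Z) :=
    ((S ⊓ ker (applyₗ x)).map (compRight K (K ∙ w).mkQ)).comap
      (compRight K Z.subtype ∘ₗ lcomp K Z (K ∙ x).mkQ)
  have h_quot := (K ∙ x).finrank_quotient_add_finrank
  rw [finrank_span_singleton hx] at h_quot
  have hP : P = ⊤ := by
    rw [eq_top_iff, ← span_surjective_eq_top (by omega), Submodule.span_le]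
    intro B hB
    obtain ⟨g, hg, hgB⟩ := hT.ge ⟨B ∘ₗ (K ∙ x).mkQ, rfl⟩
    have h_rank : k ≤ finrank K (range ((K ∙ w).mkQ ∘ₗ g)) := by
      have h_range : range ((K ∙ w).mkQ ∘ₗ g) = Z := by
        have : (K ∙ w).mkQ ∘ₗ g = Z.subtype ∘ₗ B ∘ₗ (K ∙ x).mkQ := hgB
        rw [this, range_comp, range_comp_of_range_eq_top _ (Submodule.range_mkQ _),
          range_eq_top.2 hB, Submodule.map_top, Submodule.range_subtype]
      rw [h_range, hZ]
    have hgx : g x ∈ K ∙ w := by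
      rw [← Submodule.Quotient.mk_eq_zero]
      have h := LinearMap.congr_fun hgB x
      have hx0 : (K ∙ x).mkQ x = 0 :=
        (Submodule.Quotient.mk_eq_zero _).2 (Submodule.mem_span_singleton_self x)
      simpa [hx0] using h
    have h_disj := hS.disjoint_range_of_le_finrank hg h_rank
    have hgx0 : g x = 0 := Submodule.disjoint_def.1 h_disj _ (mem_range_self g x) hgx
    exact ⟨g, ⟨hg, hgx0⟩, hgB⟩
  obtain ⟨g, ⟨hg, hgx⟩, hgB⟩ : B ∈ P := hP ▸ Submodule.mem_top
  exact ⟨g, hg, hgx, hgB⟩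

lemma RankBounded.disjoint_range [FiniteDimensional K V] [FiniteDimensional K W]
    (hS : RankBounded S k) (hw : w ≠ 0) (h_bot : slice S w = ⊥)
    (hT : S.map (compRight K (K ∙ w).mkQ) = range (compRight K Z.subtype))
    (hZ : finrank K Z = k) (hkV : k < finrank K V) {f : V →ₗ[K] W} (hf : f ∈ S) :
    Disjoint (range f) (K ∙ w) := by
  rw [Submodule.disjoint_def]
  rintro _ ⟨x, rfl⟩ hfx
  obtain rfl | hx := eq_or_ne x 0
  · exact map_zero f
  obtain ⟨B, hB⟩ := hT.le (Submodule.mem_map_of_mem hf)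
  have hBx : K ∙ x ≤ ker B := by
    rw [Submodule.span_singleton_le_iff_mem, mem_ker, ← Submodule.coe_eq_zero]
    exact (LinearMap.congr_fun hB x).trans ((Submodule.Quotient.mk_eq_zero _).2 hfx)
  obtain ⟨g, hg, hgx, hgB⟩ := hS.exists_lift_apply_eq_zero hT hZ hkV hx ((K ∙ x).liftQ B hBx)
  rw [Submodule.liftQ_mkQ] at hgB
  rw [eq_of_slice_eq_bot hw h_bot hf hg (hB.symm.trans hgB.symm), hgx]

lemma exists_mem_apply_eq (hT : S.map (compRight K (K ∙ w).mkQ) = range (compRight K Z.subtype))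
    (h_disj : ∀ f ∈ S, Disjoint (range f) (K ∙ w)) {f : V →ₗ[K] W} (hf : f ∈ S) {x₀ : V}
    (hx₀ : x₀ ≠ 0) (x : V) : ∃ g ∈ S, g x₀ = f x := by
  by_cases h_mem : x₀ ∈ K ∙ (x - x₀)
  · obtain ⟨c, hc⟩ := Submodule.mem_span_singleton.1 h_mem
    have hc0 : c ≠ 0 := by
      rintro rfl
      exact hx₀ (by rw [← hc, zero_smul])
    have hx : c⁻¹ • x₀ + x₀ = x := by
      rw [(inv_smul_eq_iff₀ hc0).2 hc.symm, sub_add_cancel]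
    exact ⟨c⁻¹ • f + f, S.add_mem (S.smul_mem _ hf) hf, by rw [← hx]; simp⟩
  have eq_zero {g : V →ₗ[K] W} (hg : g ∈ S) {y : V} (h : (K ∙ w).mkQ (g y) = 0) : g y = 0 :=
    Submodule.disjoint_def.1 (h_disj g hg) _ (mem_range_self g y)
      ((Submodule.Quotient.mk_eq_zero _).1 h)
  -- Lift the rank-one map that sends both `x₀` and `x` to the class of `f x`.
  obtain ⟨φ, hφ, hφ_ker⟩ := Submodule.exists_le_ker_of_notMem h_mem
  obtain ⟨B, hB⟩ := hT.le (Submodule.mem_map_of_mem hf)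
  have hBx : (B x : W ⧸ K ∙ w) = (K ∙ w).mkQ (f x) := LinearMap.congr_fun hB x
  obtain ⟨g, hg, hgB⟩ := hT.ge ⟨φ.smulRight ((φ x₀)⁻¹ • B x), rfl⟩
  have hg_apply (y) : (K ∙ w).mkQ (g y) = φ y • (φ x₀)⁻¹ • (K ∙ w).mkQ (f x) := by
    rw [← hBx]
    exact LinearMap.congr_fun hgB y
  have hφ_sub : φ (x - x₀) = 0 := hφ_ker (Submodule.mem_span_singleton_self _)
  have hgx : g x - g x₀ = 0 := by
    rw [← map_sub]
    exact eq_zero hg (by rw [hg_apply, hφ_sub, zero_smul])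
  have hfg : (f - g) x = 0 := by
    refine eq_zero (S.sub_mem hf hg) ?_
    rw [LinearMap.sub_apply, map_sub, hg_apply, sub_eq_zero.1 ((map_sub φ x x₀).symm.trans hφ_sub),
      smul_inv_smul₀ hφ, sub_self]
  exact ⟨g, hg, (sub_eq_zero.1 hgx).symm.trans (sub_eq_zero.1 hfg).symm⟩

lemma finrank_map_applyₗ_le [FiniteDimensional K W]
    (hT : S.map (compRight K (K ∙ w).mkQ) = range (compRight K Z.subtype))
    (h_disj : ∀ f ∈ S, Disjoint (range f) (K ∙ w)) (x : V) :
    finrank K (S.map (applyₗ x)) ≤ finrank K Z := by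
  have h_split := finrank_map_add_finrank_inf_ker (S.map (applyₗ x)) (K ∙ w).mkQ
  have h_inf : S.map (applyₗ x) ⊓ ker (K ∙ w).mkQ = ⊥ := by
    rw [Submodule.ker_mkQ, ← disjoint_iff, Submodule.disjoint_def]
    rintro _ ⟨f, hf, rfl⟩
    exact Submodule.disjoint_def.1 (h_disj f hf) _ (mem_range_self f x)
  have h_map : (S.map (applyₗ x)).map (K ∙ w).mkQ ≤ Z := by
    rintro _ ⟨_, ⟨f, hf, rfl⟩, rfl⟩
    obtain ⟨B, hB⟩ := hT.le (Submodule.mem_map_of_mem hf)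
    exact (LinearMap.congr_fun hB x) ▸ (B x).2
  rw [h_inf, finrank_bot, add_zero] at h_split
  exact h_split.ge.trans (Submodule.finrank_mono h_map)

lemma RankBounded.eq_range_compRight_subtype_of_map_mkQ [FiniteDimensional K V]
    [FiniteDimensional K W] (hS : RankBounded S k) (hw : w ≠ 0) (h_bot : slice S w = ⊥)
    (hT : S.map (compRight K (K ∙ w).mkQ) = range (compRight K Z.subtype))
    (hZ : finrank K Z = k) (hkV : k < finrank K V) :
    ∃ Z' : Submodule K W, finrank K Z' = k ∧ S = range (compRight K Z'.subtype) := by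
  have h_disj (f) (hf : f ∈ S) := hS.disjoint_range hw h_bot hT hZ hkV hf
  have hV : 0 < finrank K V := hkV.trans_le' k.zero_le
  obtain ⟨x₀, hx₀⟩ := finrank_pos_iff_exists_ne_zero.1 hV
  set Z' := S.map (applyₗ x₀)
  have hZ' : finrank K Z' ≤ k := hZ ▸ finrank_map_applyₗ_le hT h_disj x₀
  have h_le : S ≤ range (compRight K Z'.subtype) := fun f hf =>
    ⟨f.codRestrict Z' fun x => exists_mem_apply_eq hT h_disj hf hx₀ x, rfl⟩
  have hS_dim : finrank K S = finrank K V * k := by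
    rw [← finrank_map_mkQ_add_finrank_slice S hw, h_bot, finrank_bot, hT,
      finrank_range_compRight Z.injective_subtype, hZ, add_zero]
  have h_range := finrank_range_compRight (V := V) Z'.injective_subtype
  have h_mono := Submodule.finrank_mono h_le
  rw [h_range, hS_dim] at h_mono
  have hZ'k : finrank K Z' = k := hZ'.antisymm (Nat.le_of_mul_le_mul_left h_mono hV)
  exact ⟨Z', hZ'k, Submodule.eq_of_le_of_finrank_eq h_le (by rw [h_range, hS_dim, hZ'k])⟩

end Lift

theorem RankBounded.eq_range_of_finrank_eq [FiniteDimensional K V] [FiniteDimensional K W] {d : ℕ}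
    (hS : RankBounded S k) (hV : finrank K V ≤ d) (hW : finrank K W ≤ d) (hk : 0 < k) (hd : 0 < d)
    (hdim : finrank K S = d * k) :
    (finrank K W = d ∧ ∃ U : Submodule K V, finrank K (V ⧸ U) = k ∧
      S = range (lcomp K W U.mkQ)) ∨
    (finrank K V = d ∧ ∃ Z : Submodule K W, finrank K Z = k ∧
      S = range (compRight K Z.subtype)) := by
  induction h : finrank K W using Nat.strong_induction_on generalizing W with
  | _ l ih =>
  obtain hkW | hkW := le_or_gt (finrank K W) k
  · right
    have h_le := S.finrank_le
    rw [finrank_linearMap, hdim] at h_le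
    have hWk : finrank K W = k := by
      refine hkW.antisymm (Nat.le_of_mul_le_mul_left (h_le.trans ?_) hd)
      exact Nat.mul_le_mul_right _ hV
    have hVd : finrank K V = d := by
      refine hV.antisymm (Nat.le_of_mul_le_mul_right ?_ hk)
      rwa [hWk] at h_le
    refine ⟨hVd, ⊤, by rw [finrank_top, hWk], ?_⟩
    have hS_top : S = ⊤ := by
      refine Submodule.eq_top_of_finrank_eq ?_
      rw [finrank_linearMap, hdim, hVd, hWk]
    rw [hS_top, eq_comm, range_eq_top]
    exact fun f => ⟨f.codRestrict ⊤ fun _ => trivial, rfl⟩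
  by_cases h_ne : ∀ w ≠ 0, slice S w ≠ ⊥
  · exact .inl (h ▸ hS.eq_range_lcomp_mkQ hV hW hk hkW hdim h_ne)
  push Not at h_ne
  obtain ⟨w, hw, h_bot⟩ := h_ne
  have h_quot := (K ∙ w).finrank_quotient_add_finrank
  rw [finrank_span_singleton hw] at h_quot
  have h_map := finrank_map_mkQ_add_finrank_slice S hw
  rw [h_bot, finrank_bot, add_zero, hdim] at h_map
  obtain ⟨hWd, -⟩ | ⟨hVd, Z, hZ, hT⟩ :=
    ih _ (by omega) (hS.map_mkQ w) (by omega) h_map rfl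
  · omega
  · exact .inr ⟨hVd, hS.eq_range_compRight_subtype_of_map_mkQ hw h_bot hT hZ (by omega)⟩

theorem RankBounded.exists_le_rankBounded_sub_one [FiniteDimensional K V] [FiniteDimensional K W]
    {d : ℕ} (hS : RankBounded S k) (hV : finrank K V ≤ d) (hW : finrank K W ≤ d) (hk : 0 < k)
    (hd : 0 < d) (hdim : finrank K S = d * k) :
    ∃ S' ≤ S, finrank K S' = d * (k - 1) ∧ RankBounded S' (k - 1) := by
  obtain ⟨hWd, U, hU, rfl⟩ | ⟨hVd, Z, hZ, rfl⟩ := hS.eq_range_of_finrank_eq hV hW hk hd hdim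
  · obtain ⟨y, hy⟩ := finrank_pos_iff_exists_ne_zero.1 (hk.trans_eq hU.symm)
    have h_quot := (K ∙ y).finrank_quotient_add_finrank
    rw [finrank_span_singleton hy, hU] at h_quot
    have h_surj : Function.Surjective ((K ∙ y).mkQ ∘ₗ U.mkQ) :=
      (K ∙ y).mkQ_surjective.comp U.mkQ_surjective
    refine ⟨range (lcomp K W ((K ∙ y).mkQ ∘ₗ U.mkQ)), ?_, ?_, ?_⟩
    · rintro _ ⟨f, rfl⟩
      exact ⟨f ∘ₗ (K ∙ y).mkQ, rfl⟩
    · rw [finrank_range_lcomp h_surj, hWd, mul_comm, ← h_quot, Nat.add_sub_cancel]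
    · rw [← h_quot]
      exact rankBounded_range_lcomp _
  · obtain ⟨Z', hZ'Z, hZ'⟩ := exists_le_finrank_eq Z (k := k - 1) (by omega)
    refine ⟨range (compRight K Z'.subtype), ?_, ?_, ?_⟩
    · rintro _ ⟨f, rfl⟩
      exact ⟨Submodule.inclusion hZ'Z ∘ₗ f, rfl⟩
    · rw [finrank_range_compRight Z'.injective_subtype, hVd, hZ']
    · rw [← hZ']
      exact rankBounded_range_compRight _

end BoundedRank

section MaxRank

variable {F : Type*} [Field F] {a b : ℕ} {A : Submodule F (Matrix (Fin a) (Fin b) F)}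

lemma rank_le_maxrk {X : Matrix (Fin a) (Fin b) F} (hX : X ∈ A) : X.rank ≤ maxrk A :=
  le_csSup ⟨b, by rintro _ ⟨X, -, rfl⟩; exact X.rank_le_width⟩ ⟨X, hX, rfl⟩

variable (A) in
lemma exists_rank_eq_maxrk : ∃ X ∈ A, X.rank = maxrk A :=
  Nat.sSup_mem (s := {d : ℕ | ∃ X ∈ A, X.rank = d}) ⟨_, 0, A.zero_mem, rfl⟩
    ⟨b, by rintro _ ⟨X, -, rfl⟩; exact X.rank_le_width⟩

lemma maxrk_le_iff {k : ℕ} : maxrk A ≤ k ↔ ∀ X ∈ A, X.rank ≤ k := by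
  refine ⟨fun h X hX => (rank_le_maxrk hX).trans h, fun h => ?_⟩
  obtain ⟨X, hX, hX_rank⟩ := exists_rank_eq_maxrk A
  exact hX_rank ▸ h X hX

variable (A) in
lemma maxrk_le_width : maxrk A ≤ b :=
  maxrk_le_iff.2 fun X _ => X.rank_le_width

variable (A) in
lemma rankBounded_map_toLin' : RankBounded (A.map Matrix.toLin'.toLinearMap) (maxrk A) := by
  rintro _ ⟨X, hX, rfl⟩
  exact rank_le_maxrk hX

variable (A) in
lemma finrank_le_mul_maxrk (hba : b ≤ a) : finrank F A ≤ a * maxrk A := by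
  rw [← LinearEquiv.finrank_map_eq Matrix.toLin' A]
  exact (rankBounded_map_toLin' A).finrank_le (by simpa) (by simp)

lemma isOptimalAnticode_of_finrank_eq (hba : b ≤ a) (ha : 0 < a) {k : ℕ}
    (hdim : finrank F A = a * k) (hk : ∀ X ∈ A, X.rank ≤ k) :
    IsOptimalAnticode A ∧ maxrk A = k := by
  have h_maxrk : maxrk A = k := (maxrk_le_iff.2 hk).antisymm
    (Nat.le_of_mul_le_mul_left (hdim.ge.trans (finrank_le_mul_maxrk A hba)) ha)
  exact ⟨by rw [IsOptimalAnticode, hdim, h_maxrk], h_maxrk⟩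

lemma isOptimalAnticode_top (hba : b ≤ a) :
    IsOptimalAnticode (⊤ : Submodule F (Matrix (Fin a) (Fin b) F)) := by
  refine (finrank_le_mul_maxrk _ hba).antisymm ?_
  rw [finrank_top, Module.finrank_matrix]
  simpa using Nat.mul_le_mul_left a (maxrk_le_width (⊤ : Submodule F (Matrix (Fin a) (Fin b) F)))

lemma IsOptimalAnticode.exists_le_maxrk_add_one (hA : IsOptimalAnticode A) (hba : b ≤ a)
    (hpos : 0 < maxrk A) : ∃ A' ≤ A, IsOptimalAnticode A' ∧ maxrk A' + 1 = maxrk A := by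
  have ha : 0 < a := hpos.trans_le ((maxrk_le_width A).trans hba)
  obtain ⟨S, hSA, hS_dim, hS⟩ := (rankBounded_map_toLin' A).exists_le_rankBounded_sub_one
    (d := a)
    (by simpa) (by simp) hpos ha ((LinearEquiv.finrank_map_eq Matrix.toLin' A).trans hA)
  set A' := S.comap (Matrix.toLin' (R := F) (m := Fin a) (n := Fin b)).toLinearMap
  have hA'_map : A'.map Matrix.toLin'.toLinearMap = S :=
    Submodule.map_comap_eq_of_surjective Matrix.toLin'.surjective S
  have hA'A : A' ≤ A :=
    (Submodule.map_le_map_iff_of_injective Matrix.toLin'.injective _ _).1 (hA'_map.trans_le hSA)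
  have hA'_dim : finrank F A' = a * (maxrk A - 1) := by
    rw [← hS_dim, ← LinearEquiv.finrank_map_eq Matrix.toLin' A', ← hA'_map]
  obtain ⟨hA', hA'_maxrk⟩ := isOptimalAnticode_of_finrank_eq hba ha hA'_dim fun X hX => hS _ hX
  exact ⟨A', hA'A, hA', by omega⟩

end MaxRank

section Weight

variable {F : Type*} [Field F] {t : ℕ} {m n : Fin t → ℕ} {C : Submodule F (Ambient F m n)}

lemma srk_le_sum (X : Ambient F m n) : srk X ≤ ∑ i, n i :=
  Finset.sum_le_sum fun i _ => (X i).rank_le_width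

lemma srk_le_maxsrk {X : Ambient F m n} (hX : X ∈ C) : srk X ≤ maxsrk C :=
  le_csSup ⟨_, by rintro _ ⟨X, -, rfl⟩; exact srk_le_sum X⟩ ⟨X, hX, rfl⟩

variable (C) in
lemma exists_srk_eq_maxsrk : ∃ X ∈ C, srk X = maxsrk C :=
  Nat.sSup_mem (s := {d : ℕ | ∃ X ∈ C, srk X = d}) ⟨_, 0, C.zero_mem, rfl⟩
    ⟨_, by rintro _ ⟨X, -, rfl⟩; exact srk_le_sum X⟩

lemma maxsrk_pi (A : (i : Fin t) → Submodule F (Matrix (Fin (m i)) (Fin (n i)) F)) :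
    maxsrk (Submodule.pi Set.univ A) = ∑ i, maxrk (A i) := by
  apply le_antisymm
  · obtain ⟨X, hX, hX_srk⟩ := exists_srk_eq_maxsrk (Submodule.pi Set.univ A)
    rw [← hX_srk]
    exact Finset.sum_le_sum fun i _ => rank_le_maxrk (hX i trivial)
  · choose X hX hX_rank using fun i => exists_rank_eq_maxrk (A i)
    calc ∑ i, maxrk (A i) = srk (m := m) (n := n) X := by simp only [srk, hX_rank]
      _ ≤ _ := srk_le_maxsrk (Submodule.mem_pi.2 fun i _ => hX i)

lemma wt_le {A : (i : Fin t) → Submodule F (Matrix (Fin (m i)) (Fin (n i)) F)}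
    (hA : ∀ i, IsOptimalAnticode (A i)) (hCA : C ≤ Submodule.pi Set.univ A) :
    wt C ≤ ∑ i, maxrk (A i) :=
  Nat.sInf_le ⟨A, hA, hCA, maxsrk_pi A⟩

variable (C) in
lemma exists_wt_eq (hmn : ∀ i, n i ≤ m i) :
    ∃ A : (i : Fin t) → Submodule F (Matrix (Fin (m i)) (Fin (n i)) F),
      (∀ i, IsOptimalAnticode (A i)) ∧ C ≤ Submodule.pi Set.univ A ∧ wt C = ∑ i, maxrk (A i) := by
  obtain ⟨A, hA, hCA, hA_wt⟩ := Nat.sInf_mem (s := {w : ℕ |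
    ∃ A : (i : Fin t) → Submodule F (Matrix (Fin (m i)) (Fin (n i)) F),
      (∀ i, IsOptimalAnticode (A i)) ∧ C ≤ Submodule.pi Set.univ A ∧
        maxsrk (Submodule.pi Set.univ A) = w})
    ⟨_, fun _ => ⊤, fun i => isOptimalAnticode_top (hmn i), fun _ _ _ _ => trivial, rfl⟩
  exact ⟨A, hA, hCA, hA_wt.symm.trans (maxsrk_pi A)⟩

variable (C) in
lemma wt_le_sum (hmn : ∀ i, n i ≤ m i) : wt C ≤ ∑ i, n i :=
  (wt_le (A := fun _ => ⊤) (fun i => isOptimalAnticode_top (hmn i)) fun _ _ _ _ => trivial).trans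
    (Finset.sum_le_sum fun _ _ => maxrk_le_width _)

lemma srk_le_wt (hmn : ∀ i, n i ≤ m i) {X : Ambient F m n} (hX : X ∈ C) : srk X ≤ wt C := by
  obtain ⟨A, -, hCA, hA_wt⟩ := exists_wt_eq C hmn
  rw [hA_wt, ← maxsrk_pi]
  exact srk_le_maxsrk (hCA hX)

lemma wt_inf_comap_proj_lt {A : (i : Fin t) → Submodule F (Matrix (Fin (m i)) (Fin (n i)) F)}
    (hA : ∀ i, IsOptimalAnticode (A i)) (hCA : C ≤ Submodule.pi Set.univ A) {i : Fin t}
    {A' : Submodule F (Matrix (Fin (m i)) (Fin (n i)) F)} (hA' : IsOptimalAnticode A')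
    (h_lt : maxrk A' < maxrk (A i)) : wt (C ⊓ A'.comap (proj i)) < ∑ l, maxrk (A l) := by
  have h_opt : ∀ l, IsOptimalAnticode (Function.update A i A' l) :=
    (Function.forall_update_iff A fun _ B => IsOptimalAnticode B).2 ⟨hA', fun l _ => hA l⟩
  have h_sub : C ⊓ A'.comap (proj i) ≤ Submodule.pi Set.univ (Function.update A i A') :=
    fun X hX l _ => (Function.forall_update_iff A fun l B => X l ∈ B).2
      ⟨hX.2, fun l _ => hCA hX.1 l trivial⟩ l
  have h_maxrk : ∀ l, maxrk (Function.update A i A' l) ≤ maxrk (A l) :=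
    (Function.forall_update_iff A fun l B => maxrk B ≤ maxrk (A l)).2 ⟨h_lt.le, fun _ _ => le_rfl⟩
  calc wt (C ⊓ A'.comap (proj i)) ≤ ∑ l, maxrk (Function.update A i A' l) := wt_le h_opt h_sub
    _ < ∑ l, maxrk (A l) := Finset.sum_lt_sum (fun l _ => h_maxrk l)
        ⟨i, Finset.mem_univ i, by rwa [Function.update_self]⟩

lemma exists_le_wt_lt (hm : Antitone m) (hmn : ∀ i, n i ≤ m i) {i : Fin t}
    (hi : ∑ l ∈ Finset.Iio i, n l < wt C) :
    ∃ C' ≤ C, wt C' < wt C ∧ finrank F C ≤ finrank F C' + m i := by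
  obtain ⟨A, hA, hCA, hA_wt⟩ := exists_wt_eq C hmn
  obtain ⟨l, hil, hl⟩ : ∃ l, i ≤ l ∧ 0 < maxrk (A l) := by
    by_contra! h
    refine hi.not_ge ?_
    rw [hA_wt, ← Finset.sum_subset (Finset.subset_univ (Finset.Iio i)) fun l _ hl =>
      Nat.le_zero.1 (h l (not_lt.1 (mt Finset.mem_Iio.2 hl)))]
    exact Finset.sum_le_sum fun l _ => maxrk_le_width (A l)
  obtain ⟨A', hA'A, hA', h_maxrk⟩ := (hA l).exists_le_maxrk_add_one (hmn l) hl
  refine ⟨C ⊓ A'.comap (proj l), inf_le_left, ?_, ?_⟩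
  · rw [hA_wt]
    exact wt_inf_comap_proj_lt hA hCA hA' (by omega)
  · have h_map : C.map (proj l) ≤ A l :=
      Submodule.map_le_iff_le_comap.2 fun X hX => hCA hX l trivial
    have h_dim := finrank_le_finrank_inf_comap (C := C) (proj l) h_map hA'A
    rw [hA l, hA', ← h_maxrk, mul_add, mul_one] at h_dim
    have := hm hil
    omega

end Weight

section GeneralizedWeights

variable {F : Type*} [Field F] {t : ℕ} {m n : Fin t → ℕ} {C D : Submodule F (Ambient F m n)}

lemma genWeight_le {C' : Submodule F (Ambient F m n)} (h : C' ≤ C) {r : ℕ}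
    (hr : r ≤ finrank F C') : genWeight C r ≤ wt C' :=
  Nat.sInf_le ⟨C', h, hr, rfl⟩

lemma exists_genWeight_eq {r : ℕ} (hr : r ≤ finrank F C) :
    ∃ C' ≤ C, r ≤ finrank F C' ∧ wt C' = genWeight C r :=
  Nat.sInf_mem (s := {w : ℕ | ∃ C' : Submodule F (Ambient F m n),
    C' ≤ C ∧ r ≤ finrank F C' ∧ wt C' = w}) ⟨_, C, le_rfl, hr, rfl⟩

lemma genWeight_mono {r s : ℕ} (hrs : r ≤ s) (hs : s ≤ finrank F C) :
    genWeight C r ≤ genWeight C s := by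
  obtain ⟨C', hC', hs', hC'_wt⟩ := exists_genWeight_eq hs
  exact hC'_wt ▸ genWeight_le hC' (hrs.trans hs')

lemma monotone_genWeightSeq (C : Submodule F (Ambient F m n)) : Monotone (genWeightSeq C) :=
  fun _ s hrs => genWeight_mono (Nat.succ_le_succ hrs) s.2

lemma minDist_le_genWeightSeq (hmn : ∀ i, n i ≤ m i) (hCD : C ≤ D) (r : Fin (finrank F C)) :
    minDist D ≤ genWeightSeq C r := by
  obtain ⟨C', hC', hr, hC'_wt⟩ := exists_genWeight_eq (C := C) r.2
  have hC'_ne : C' ≠ ⊥ := Submodule.one_le_finrank_iff.1 (r.val.succ_pos.trans_le hr)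
  obtain ⟨X, hX, hX0⟩ := Submodule.exists_mem_ne_zero_of_ne_bot hC'_ne
  calc minDist D ≤ srk X := Nat.sInf_le ⟨X, hCD (hC' hX), hX0, rfl⟩
    _ ≤ wt C' := srk_le_wt hmn hX
    _ = genWeightSeq C r := hC'_wt

lemma genWeightSeq_le_sum (hmn : ∀ i, n i ≤ m i) (r : Fin (finrank F C)) :
    genWeightSeq C r ≤ ∑ i, n i := by
  obtain ⟨C', -, -, hC'_wt⟩ := exists_genWeight_eq (C := C) r.2
  exact hC'_wt.symm.trans_le (wt_le_sum C' hmn)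

lemma lt_add_of_genWeight_eq (hm : Antitone m) (hmn : ∀ i, n i ≤ m i) {r s : ℕ}
    (hs : s ≤ finrank F C) (hrs : genWeight C r = genWeight C s) {i : Fin t}
    (hi : ∑ l ∈ Finset.Iio i, n l < genWeight C s) : s < r + m i := by
  obtain ⟨C', hC', hs', hC'_wt⟩ := exists_genWeight_eq hs
  obtain ⟨C'', hC'', h_lt, hdim⟩ := exists_le_wt_lt hm hmn (hC'_wt ▸ hi)
  by_contra! h
  have := genWeight_le (hC''.trans hC') (r := r) (by omega)
  omega

lemma card_le_of_forall_lt_add {s : Finset ℕ} {c : ℕ} (h : ∀ x ∈ s, ∀ y ∈ s, x < y + c) :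
    s.card ≤ c := by
  obtain rfl | hs := s.eq_empty_or_nonempty
  · exact c.zero_le
  calc s.card ≤ (Finset.Ico (s.min' hs) (s.min' hs + c)).card := Finset.card_le_card fun x hx =>
        Finset.mem_Ico.2 ⟨s.min'_le x hx, h x hx _ (s.min'_mem hs)⟩
    _ = c := by simp

variable (C) in
lemma card_genWeightSeq_eq_le (hm : Antitone m) (hmn : ∀ i, n i ≤ m i) {i : Fin t} {w : ℕ}
    (hi : ∑ l ∈ Finset.Iio i, n l < w) :
    (Finset.univ.filter fun r => genWeightSeq C r = w).card ≤ m i := by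
  rw [← Finset.card_map Fin.valEmbedding]
  refine card_le_of_forall_lt_add ?_
  simp only [Finset.forall_mem_map, Finset.mem_filter_univ, Fin.valEmbedding_apply]
  rintro s rfl r hr
  have := lt_add_of_genWeight_eq hm hmn (C := C) (r := r + 1) (s := s + 1) s.2 hr hi
  omega

end GeneralizedWeights

section Blocks

variable {t : ℕ} {m n : Fin t → ℕ}

lemma sum_Iio_castSucc (n : Fin (t + 1) → ℕ) (i : Fin t) :
    ∑ l ∈ Finset.Iio i.castSucc, n l = ∑ l ∈ Finset.Iio i, n l.castSucc := by
  rw [← Fin.map_castSuccEmb_Iio, Finset.sum_map]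
  rfl

lemma sum_Ioc_sum_eq_sum_sum_Ioc (n : Fin t → ℕ) (f : ℕ → ℕ) :
    ∑ w ∈ Finset.Ioc 0 (∑ i, n i), f w =
      ∑ i, ∑ w ∈ Finset.Ioc (∑ l ∈ Finset.Iio i, n l) (∑ l ∈ Finset.Iio i, n l + n i), f w := by
  induction t with
  | zero => simp
  | succ t ih =>
    have h_last : ∑ l ∈ Finset.Iio (Fin.last t), n l = ∑ l : Fin t, n l.castSucc := by
      rw [Fin.Iio_last_eq_map, Finset.sum_map]
      rfl
    rw [Fin.sum_univ_castSucc, Fin.sum_univ_castSucc, h_last]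
    simp only [sum_Iio_castSucc]
    rw [← ih fun i => n i.castSucc,
      Finset.sum_Ioc_consecutive _ (Nat.zero_le _) (Nat.le_add_right _ _)]

lemma exists_sum_Iio_lt_le {w : ℕ} (hw : 0 < w) (hwn : w ≤ ∑ i, n i) :
    ∃ i, ∑ l ∈ Finset.Iio i, n l < w ∧ w ≤ ∑ l ∈ Finset.Iio i, n l + n i := by
  have h_sum := sum_Ioc_sum_eq_sum_sum_Ioc n fun x => if x = w then 1 else 0
  simp only [Finset.sum_ite_eq', Finset.mem_Ioc, hw, hwn, and_self, if_true] at h_sum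
  obtain ⟨i, -, hi⟩ := Finset.exists_ne_zero_of_sum_ne_zero (h_sum.symm.trans_ne one_ne_zero)
  exact ⟨i, by simpa only [ne_eq, ite_eq_right_iff, one_ne_zero, imp_false, not_not] using hi⟩

lemma sum_Iio_add_le_sum_Iio {i j : Fin t} (hij : i < j) :
    ∑ l ∈ Finset.Iio i, n l + n i ≤ ∑ l ∈ Finset.Iio j, n l := by
  rw [add_comm, ← Finset.sum_insert Finset.notMem_Iio_self, Finset.Iio_insert]
  exact Finset.sum_le_sum_of_subset fun l hl =>
    Finset.mem_Iio.2 ((Finset.mem_Iic.1 hl).trans_lt hij)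

lemma sum_Ioc_ite_lt (a x y c : ℕ) :
    ∑ w ∈ Finset.Ioc x y, (if a < w then c else 0) = (y - max a x) * c := by
  have h_filter : (Finset.Ioc x y).filter (a < ·) = Finset.Ioc (max a x) y := by
    ext w
    simp only [Finset.mem_filter, Finset.mem_Ioc]
    omega
  rw [← Finset.sum_filter, h_filter, Finset.sum_const, Nat.card_Ioc, smul_eq_mul]

lemma sum_sum_Ioc_ite_add {j : Fin t} {δ : ℕ} (hδ : δ < n j) :
    ∑ i, ∑ w ∈ Finset.Ioc (∑ l ∈ Finset.Iio i, n l) (∑ l ∈ Finset.Iio i, n l + n i),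
        (if ∑ l ∈ Finset.Iio j, n l + δ < w then m i else 0) + δ * m j =
      ∑ i ∈ Finset.Ici j, m i * n i := by
  have h_term (i : Fin t) :
      (∑ l ∈ Finset.Iio i, n l + n i - max (∑ l ∈ Finset.Iio j, n l + δ) (∑ l ∈ Finset.Iio i, n l))
        * m i + (if i = j then δ * m j else 0) = if j ≤ i then m i * n i else 0 := by
    obtain hij | rfl | hji := lt_trichotomy i j
    · have := sum_Iio_add_le_sum_Iio (n := n) hij
      rw [if_neg hij.ne, if_neg hij.not_ge, Nat.sub_eq_zero_of_le (by omega), zero_mul]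
    · rw [if_pos rfl, if_pos le_rfl, ← add_mul, mul_comm]
      congr 1
      omega
    · have := sum_Iio_add_le_sum_Iio (n := n) hji
      rw [if_neg hji.ne', if_pos hji.le, max_eq_right (by omega), Nat.add_sub_cancel_left,
        add_zero, mul_comm]
  have h_Ici : Finset.univ.filter (j ≤ ·) = Finset.Ici j := by
    ext i
    simp
  rw [← h_Ici, Finset.sum_filter]
  simp only [sum_Ioc_ite_lt, ← h_term, Finset.sum_add_distrib, Finset.sum_ite_eq', Finset.mem_univ,
    if_true]

end Blocks

section Multiplicity

variable {F : Type*} [Field F] {t : ℕ} {m n : Fin t → ℕ} {D : Submodule F (Ambient F m n)}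

lemma sum_sum_Ioc_card_genWeightSeq_eq (hmn : ∀ i, n i ≤ m i) (hD : 0 < minDist D) :
    ∑ i, ∑ w ∈ Finset.Ioc (∑ l ∈ Finset.Iio i, n l) (∑ l ∈ Finset.Iio i, n l + n i),
      (Finset.univ.filter fun r => genWeightSeq D r = w).card = finrank F D := by
  rw [← sum_Ioc_sum_eq_sum_sum_Ioc, ← Finset.card_eq_sum_card_fiberwise, Finset.card_fin]
  exact fun r _ => Finset.mem_coe.2 (Finset.mem_Ioc.2
    ⟨hD.trans_le (minDist_le_genWeightSeq hmn le_rfl r), genWeightSeq_le_sum hmn r⟩)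

lemma IsMSRD.minDist_pos (hD : IsMSRD D) : 0 < minDist D := by
  obtain ⟨j, δ, -, hd, -⟩ := hD
  omega

-- The dimension of an MSRD code is the sum of the upper bounds `m i` over all possible values of
-- its generalized weights, so all these bounds are attained.
lemma IsMSRD.card_genWeightSeq_eq (hm : Antitone m) (hmn : ∀ i, n i ≤ m i) (hD : IsMSRD D)
    {i : Fin t} {w : ℕ} (hwD : minDist D ≤ w) (hiw : ∑ l ∈ Finset.Iio i, n l < w)
    (hwi : w ≤ ∑ l ∈ Finset.Iio i, n l + n i) :
    (Finset.univ.filter fun r => genWeightSeq D r = w).card = m i := by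
  have h_pos := hD.minDist_pos
  obtain ⟨j, δ, hδ, hd, hdim⟩ := hD
  have h_le (i : Fin t) : ∀ w ∈ Finset.Ioc (∑ l ∈ Finset.Iio i, n l)
      (∑ l ∈ Finset.Iio i, n l + n i), (Finset.univ.filter fun r => genWeightSeq D r = w).card ≤
        if ∑ l ∈ Finset.Iio j, n l + δ < w then m i else 0 := by
    intro w hw
    split_ifs with hwδ
    · exact card_genWeightSeq_eq_le D hm hmn (Finset.mem_Ioc.1 hw).1
    · refine (Finset.card_eq_zero.2 (Finset.filter_eq_empty_iff.2 ?_)).le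
      rintro r - rfl
      have := minDist_le_genWeightSeq hmn le_rfl r
      omega
  have h_sum := sum_sum_Ioc_card_genWeightSeq_eq hmn h_pos
  have h_bound := sum_sum_Ioc_ite_add (m := m) hδ
  have h_eq := (Finset.sum_eq_sum_iff_of_le (s := Finset.univ)
    fun i _ => Finset.sum_le_sum (h_le i)).1 (by omega)
  rw [(Finset.sum_eq_sum_iff_of_le (h_le i)).1 (h_eq i (Finset.mem_univ i)) w
    (Finset.mem_Ioc.2 ⟨hiw, hwi⟩), if_pos (by omega)]

end Multiplicity

section Subsequence

lemma count_ofFn {k : ℕ} (a : Fin k → ℕ) (w : ℕ) :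
    (List.ofFn a).count w = (Finset.univ.filter fun r => a r = w).card := by
  rw [← Multiset.coe_count, ← Fin.univ_val_map, Multiset.count_map, Finset.card_def,
    Finset.filter_val]
  simp only [eq_comm]

lemma isSubsequence_of_sublist {k l : ℕ} {a : Fin k → ℕ} {b : Fin l → ℕ}
    (h : (List.ofFn a).Sublist (List.ofFn b)) : IsSubsequence a b := by
  obtain ⟨f, hf⟩ := List.sublist_iff_exists_fin_orderEmbedding_get_eq.1 h
  refine ⟨fun r => (f (r.cast List.length_ofFn.symm)).cast List.length_ofFn, fun r s hrs => ?_,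
    fun r => ?_⟩
  · exact f.strictMono (show r.cast List.length_ofFn.symm < s.cast List.length_ofFn.symm from hrs)
  · have h_get := hf (r.cast List.length_ofFn.symm)
    rw [List.get_ofFn, List.get_ofFn] at h_get
    exact h_get

lemma isSubsequence_of_card_le {k l : ℕ} {a : Fin k → ℕ} {b : Fin l → ℕ} (ha : Monotone a)
    (hb : Monotone b) (h : ∀ w, (Finset.univ.filter fun r => a r = w).card ≤
      (Finset.univ.filter fun r => b r = w).card) : IsSubsequence a b := by
  refine isSubsequence_of_sublist (List.sublist_of_subperm_of_sortedLE
    (List.subperm_ext_iff.2 fun w _ => ?_) ha.sortedLE_ofFn hb.sortedLE_ofFn)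
  rw [count_ofFn, count_ofFn]
  exact h w

end Subsequence

end SumRank

theorem proposition4p5_general {F : Type*} [Field F] {t : ℕ} (m n : Fin t → ℕ)
    (hm : Antitone m) (hmn : ∀ i, n i ≤ m i)
    (C D : Submodule F (SumRank.Ambient F m n)) (hCD : C ≤ D) (hD : SumRank.IsMSRD D) :
    SumRank.IsSubsequence (SumRank.genWeightSeq C) (SumRank.genWeightSeq D) := by
  refine SumRank.isSubsequence_of_card_le (SumRank.monotone_genWeightSeq C)
    (SumRank.monotone_genWeightSeq D) fun w => ?_
  obtain h_empty | ⟨r, hr⟩ :=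
    (Finset.univ.filter fun r => SumRank.genWeightSeq C r = w).eq_empty_or_nonempty
  · simp [h_empty]
  obtain rfl : SumRank.genWeightSeq C r = w := (Finset.mem_filter.1 hr).2
  have hwD := SumRank.minDist_le_genWeightSeq hmn hCD r
  obtain ⟨i, hiw, hwi⟩ := SumRank.exists_sum_Iio_lt_le (hD.minDist_pos.trans_le hwD)
    (SumRank.genWeightSeq_le_sum hmn r)
  rw [hD.card_genWeightSeq_eq hm hmn hwD hiw hwi]
  exact SumRank.card_genWeightSeq_eq_le C hm hmn hiw

theorem proposition4p5 {F : Type*} [Field F] [Finite F] {t : ℕ} (m n : Fin t → ℕ)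
    (hn : ∀ i, 0 < n i) (hm : Antitone m) (hmn : ∀ i, n i ≤ m i)
    (C D : Submodule F (SumRank.Ambient F m n)) (hCD : C ≤ D) (hD : SumRank.IsMSRD D) :
    SumRank.IsSubsequence (SumRank.genWeightSeq C) (SumRank.genWeightSeq D) :=
  proposition4p5_general m n hm hmn C D hCD hD
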